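/- Let $d\ge 2$, $N\in\mathbb N$ and $\alpha,\beta>0$. **Graphs and networks.** An $N$-graph $G$ is the topological quotient of the disjoint union of $N$ copies of $[0,1]$ (the edges) by an equivalence relation on the set $\{0,1\}\times\{1,\dots,N\}$ of endpoints $(z,i)$; a subgraph is given by a subset of the edges, with the induced identifications. Assigned angles on $G$ are unit vectors $d^{z,i}\in\mathbb S^{d-1}$, one for each endpoint $(z,i)$; subgraphs inherit them. A network is a pair $\mathcal N=(G,\Gamma)$ with $\Gamma:G\to\mathbb R^d$ continuous such that each curve $\gamma^i:=\Gamma|_{E_i}:[0,1]\to\mathbb R^d$ is either constant (singular) or an immersion of class $H^2$ (regular). $\mathrm{Sing}(\mathcal N)$ is the subgraph formed by the singular edges, and $\mathcal N$ is regular if it is empty. The outer tangent of a regular curve at an endpoint is $\tau^{z,i}=(-1)^z\dot\gamma^i(z)/|\dot\gamma^i(z)|$. **Angle condition.** $\mathcal N$ satisfies the angle condition with tangents $(\tau^{z,i})$ if $\tau^{z,i}$ is the outer tangent when $\gamma^i$ is regular, $\tau^{0,i}=-\tau^{1,i}$ are unit vectors (virtual tangents) when $\gamma^i$ is singular, and for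 every vertex $p$ of $G$ there is a rotation $R_p\in SO(d)$ with $\tau^{z,i}=R_p(d^{z,i})$ for all endpoints $(z,i)$ in the class $p$. $\mathcal C_{\mathrm{Reg}}$ is the class of regular networks that satisfy the angle condition. **Degenerate networks.** A subgraph $H$ is stratified straight with tangents $(\tau^{z,i})$ if there are subgraphs $\emptyset=H_q\subseteq\dots\subseteq H_1\subseteq H_0=H$ and networks $(H_j,\Sigma_j)$, $0\le j<q$, satisfying the angle condition with tangents given by these $\tau^{z,i}$, whose regular curves are straight segments, and with $H_{j+1}=\mathrm{Sing}(H_j,\Sigma_j)$. The network $\mathcal N$ is degenerate, $\mathcal N\in\mathcal C_{\mathrm{Deg}}$, if there are tangents $(\tau^{z,i})$ with which $\mathcal N$ satisfies the angle condition and $\mathrm{Sing}(\mathcal N)$ is stratified straight. **Energy.** Put $\mathcal E(\mathcal N)=\sum_{i=1}^N\big(\alpha\int_{\gamma^i}|\vec k^i|^2\,ds+\beta\,\ell(\gamma^i)\big)$, where $\ell$ is the length, $\vec k^i$ is the curvature vector of a regular curve, and $\vec k^i=0$ on singular curves. Let $\overline{\mathcal E}(\mathcal N)=\mathcal E(\mathcal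 N)$ if $\mathcal N\in\mathcal C_{\mathrm{Deg}}$ and $\overline{\mathcal E}(\mathcal N)=+\infty$ otherwise. **Theorem (Recovery sequence).** Let $G$ be an $N$-graph with assigned angles. For every $\mathcal N=(G,\Gamma)\in\mathcal C_{\mathrm{Deg}}$ there is a sequence of networks $\mathcal N_n=(G,\Gamma_n)\in\mathcal C_{\mathrm{Reg}}$ such that $\mathcal N_n\to\mathcal N$ strongly in $H^2$, that is, for every $i$ the curves $\gamma^i_n$ converge to $\gamma^i$ in $H^2(0,1)$ up to orientation-preserving reparametrization of the $\gamma_n^i$ and of $\gamma^i$, and such that $\mathcal E(\mathcal N_n)\to\overline{\mathcal E}(\mathcal N)$ as $n\to\infty$. -/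

import Mathlib

open MeasureTheory Set Filter Topology

noncomputable section

/-- The ambient Euclidean space `ℝ^d`. -/
abbrev Euc (d : ℕ) : Type := EuclideanSpace ℝ (Fin d)

/-! ### Curves of class `H²` on `[0,1]` -/

section Curves

variable {F : Type*} [NormedAddCommGroup F] [NormedSpace ℝ F]

/-- First derivative on `[0,1]` (one-sided at the endpoints). -/
def d1 (f : ℝ → F) : ℝ → F := derivWithin f (Icc 0 1)

/-- Second derivative on `[0,1]`; for `f` of class `H²` it exists almost everywhere and is the weak
second derivative. -/
def d2 (f : ℝ → F) : ℝ → F := derivWithin (d1 f) (Icc 0 1)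

/-- `f ∈ H²(0,1)` (continuous representative): `f` is `C¹` on `[0,1]`, `f'` is absolutely
continuous, and `f''` is square integrable. Only the values of `f` on `[0,1]` matter. -/
structure IsH2 (f : ℝ → F) : Prop where
  contDiffOn : ContDiffOn ℝ 1 f (Icc 0 1)
  absCont : AbsolutelyContinuousOnInterval (d1 f) 0 1
  memLp : MemLp (d2 f) 2 (volume.restrict (Icc (0 : ℝ) 1))

/-- The norm of `H²(0,1)`:
`‖f‖² = ‖f‖²_{L²} + ‖f'‖²_{L²} + ‖f''‖²_{L²}`, with values in `[0,∞]`. -/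
def h2Norm (f : ℝ → F) : ENNReal :=
  (eLpNorm f 2 (volume.restrict (Icc (0 : ℝ) 1)) ^ 2
    + eLpNorm (d1 f) 2 (volume.restrict (Icc (0 : ℝ) 1)) ^ 2
    + eLpNorm (d2 f) 2 (volume.restrict (Icc (0 : ℝ) 1)) ^ 2) ^ (1 / 2 : ℝ)

/-- The curve `γ : [0,1] → F` is constant. -/
def IsConstantCurve (γ : ℝ → F) : Prop := ∃ c : F, ∀ t ∈ Icc (0 : ℝ) 1, γ t = c

/-- The curve `γ : [0,1] → F` is an immersion of class `H²`. -/
def IsH2Immersion (γ : ℝ → F) : Prop := IsH2 γ ∧ ∀ t ∈ Icc (0 : ℝ) 1, d1 γ t ≠ 0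

/-- The image of `γ : [0,1] → F` is the straight segment between its endpoints. -/
def IsStraightSegment (γ : ℝ → F) : Prop := γ '' Icc (0 : ℝ) 1 = segment ℝ (γ 0) (γ 1)

/-- Orientation preserving `H²`-diffeomorphisms of `[0,1]`. -/
structure IsReparam (φ : ℝ → ℝ) : Prop where
  isH2 : IsH2 φ
  map_zero : φ 0 = 0
  map_one : φ 1 = 1
  deriv_pos : ∀ t ∈ Icc (0 : ℝ) 1, 0 < d1 φ t

/-- The length of a curve. -/
def curveLength (γ : ℝ → F) : ℝ := ∫ t in (0 : ℝ)..1, ‖d1 γ t‖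

/-- The parameter `z ∈ {0,1}` as a point of `[0,1]`. -/
def endParam (z : Fin 2) : unitInterval := if z = 0 then 0 else 1

/-- The outer tangent `(-1)^z γ'(z) / |γ'(z)|`, for `z ∈ {0,1}`. -/
def outerTangent (γ : ℝ → F) (z : Fin 2) : F :=
  (-1 : ℝ) ^ (z : ℕ) • (‖d1 γ (endParam z)‖⁻¹ • d1 γ (endParam z))

end Curves

/-- The curvature vector `γ''/|γ'|² - ⟨γ'',γ'⟩ γ'/|γ'|⁴` of an immersed curve. -/
def curvatureVec {d : ℕ} (γ : ℝ → Euc d) (t : ℝ) : Euc d :=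
  (1 / ‖d1 γ t‖ ^ 2) • d2 γ t - (inner ℝ (d2 γ t) (d1 γ t) / ‖d1 γ t‖ ^ 4) • d1 γ t

/-! ### Graphs -/

/-- A graph with edges indexed by `ι`: an equivalence relation on the endpoints `(z,i)`,
`z ∈ {0,1}`, `i ∈ ι`, of the edges. For `ι = Fin N` this is an `N`-graph. -/
structure NGraph (ι : Type) where
  rel : Setoid (Fin 2 × ι)

namespace NGraph

variable {ι : Type}

/-- The vertices of the graph. -/
abbrev Vertex (G : NGraph ι) : Type := Quotient G.rel

/-- The projection of endpoints of edges to vertices. -/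
def proj (G : NGraph ι) (x : Fin 2 × ι) : G.Vertex := Quotient.mk G.rel x

/-- The relation that glues the endpoints of the disjoint union of copies of `[0,1]`. -/
def glue (G : NGraph ι) (x y : Σ _ : ι, unitInterval) : Prop :=
  ∃ z w : Fin 2, x.2 = endParam z ∧ y.2 = endParam w ∧ G.rel (z, x.1) (w, y.1)

/-- The topological quotient of the disjoint union of copies of `[0,1]`. -/
abbrev Space (G : NGraph ι) : Type := Quot G.glue

/-- The subgraph with edge set `H`; endpoints are identified as in `G`. -/
def sub (G : NGraph ι) (H : Set ι) : NGraph H where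
  rel := G.rel.comap (fun x => (x.1, (x.2 : ι)))

end NGraph

/-- Assigned directions: a unit vector for every endpoint `(z,i)` of an edge. -/
abbrev Directions (ι : Type) (d : ℕ) : Type := Fin 2 × ι → Metric.sphere (0 : Euc d) 1

/-- A family of vectors, one for every endpoint `(z,i)` of an edge (real or virtual tangents). -/
abbrev TangentFamily (ι : Type) (d : ℕ) : Type := Fin 2 × ι → Euc d

/-- The restriction to a subgraph of a family indexed by the endpoints of the edges. -/
def restrictToSub {ι : Type} {X : Type} (f : Fin 2 × ι → X) (H : Set ι) : Fin 2 × H → X :=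
  fun x => f (x.1, (x.2 : ι))

/-- Rotations of `ℝ^d`: orientation preserving linear isometries. -/
def IsRotation {d : ℕ} (R : Euc d ≃ₗᵢ[ℝ] Euc d) : Prop :=
  LinearMap.det (R.toLinearEquiv : Euc d →ₗ[ℝ] Euc d) = 1

/-! ### Networks -/

/-- A network `(G, Γ)` in `ℝ^d`: a continuous map `Γ : G → ℝ^d` whose restriction to each edge is
either constant or an immersion of class `H²`. -/
structure Network {ι : Type} (G : NGraph ι) (d : ℕ) where
  Γ : C(G.Space, Euc d)
  curve_spec : ∀ i : ι,
    IsConstantCurve (IccExtend (zero_le_one' ℝ) fun t => Γ (Quot.mk G.glue ⟨i, t⟩)) ∨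
    IsH2Immersion (IccExtend (zero_le_one' ℝ) fun t => Γ (Quot.mk G.glue ⟨i, t⟩))

namespace Network

variable {ι : Type} {G : NGraph ι} {d : ℕ}

/-- The curve `γ^i`, the restriction of `Γ` to the edge `i`, as a map on `[0,1]`
(extended to `ℝ` by constants). -/
def curve (𝒩 : Network G d) (i : ι) : ℝ → Euc d :=
  IccExtend (zero_le_one' ℝ) fun t => 𝒩.Γ (Quot.mk G.glue ⟨i, t⟩)

/-- The edges of the singular part: those mapped to a point. -/
def sing (𝒩 : Network G d) : Set ι := {i | IsConstantCurve (𝒩.curve i)}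

/-- A network is regular if its singular part is empty. -/
def IsRegular (𝒩 : Network G d) : Prop := 𝒩.sing = ∅

/-- The angle condition for a regular network: at every vertex `p` the outer tangents are the
assigned directions up to a rotation depending on `p`. -/
def AngleCondition (D : Directions ι d) (𝒩 : Network G d) : Prop :=
  ∀ p : G.Vertex, ∃ R : Euc d ≃ₗᵢ[ℝ] Euc d, IsRotation R ∧
    ∀ (z : Fin 2) (i : ι), G.proj (z, i) = p → outerTangent (𝒩.curve i) z = R (D (z, i))

/-- The angle condition for a possibly singular network, with the (real or virtual) tangents `τ`:
on regular curves `τ` are the outer tangents, on singular curves `τ` are unit vectors with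
`τ^{0,i} = -τ^{1,i}`, and at every vertex `p` the `τ`'s are the assigned directions up to a
rotation depending on `p`. -/
structure AngleConditionWith (D : Directions ι d) (𝒩 : Network G d)
    (τ : TangentFamily ι d) : Prop where
  real : ∀ i ∉ 𝒩.sing, ∀ z : Fin 2, τ (z, i) = outerTangent (𝒩.curve i) z
  virtual_unit : ∀ i ∈ 𝒩.sing, ∀ z : Fin 2, ‖τ (z, i)‖ = 1
  virtual_opposite : ∀ i ∈ 𝒩.sing, τ (0, i) = -τ (1, i)
  angles : ∀ p : G.Vertex, ∃ R : Euc d ≃ₗᵢ[ℝ] Euc d, IsRotation R ∧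
    ∀ (z : Fin 2) (i : ι), G.proj (z, i) = p → τ (z, i) = R (D (z, i))

/-- The class of regular networks that fulfil the angle condition. -/
def InCReg (D : Directions ι d) (𝒩 : Network G d) : Prop :=
  𝒩.IsRegular ∧ 𝒩.AngleCondition D

end Network

/-- The subgraph `H` of `G` is stratified straight, with (real or virtual) tangents `τ`: there are
strata `∅ = H_q ⊆ … ⊆ H_1 ⊆ H_0 = H` and networks `(H_j, Σ_j)`, `j < q`, that satisfy the angle
condition with tangents given by `τ`, whose regular curves are straight segments, and such that
`H_{j+1}` is the singular part of `(H_j, Σ_j)`. (The values of `S j` for `j ≥ q` are irrelevant.) -/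
def StratifiedStraightWith {ι : Type} {d : ℕ} (G : NGraph ι) (D : Directions ι d) (H : Set ι)
    (τ : TangentFamily ι d) : Prop :=
  ∃ (q : ℕ) (stratum : ℕ → Set ι) (S : (j : ℕ) → Network (G.sub (stratum j)) d),
    stratum 0 = H ∧ stratum q = ∅ ∧
    ∀ j < q,
      (S j).AngleConditionWith (restrictToSub D (stratum j)) (restrictToSub τ (stratum j)) ∧
      (∀ i ∉ (S j).sing, IsStraightSegment ((S j).curve i)) ∧
      stratum (j + 1) = Subtype.val '' (S j).sing

namespace Network

variable {ι : Type} {G : NGraph ι} {d : ℕ}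

/-- The class of degenerate networks: the angle condition holds and the singular part is
stratified straight, with the same (real or virtual) tangents. -/
def InCDeg (D : Directions ι d) (𝒩 : Network G d) : Prop :=
  ∃ τ : TangentFamily ι d, 𝒩.AngleConditionWith D τ ∧ StratifiedStraightWith G D 𝒩.sing τ

open Classical in
/-- The curvature of the curve `γ^i`, set to zero on singular curves. -/
def curvature (𝒩 : Network G d) (i : ι) (t : ℝ) : Euc d :=
  if i ∈ 𝒩.sing then 0 else curvatureVec (𝒩.curve i) t

/-- The elastic energy `∑ i, (α ∫ |k^i|² ds + β ℓ(γ^i))` of a regular or singular network, with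
`ds = |γ'| dt`. -/
def energy [Fintype ι] (α β : ℝ) (𝒩 : Network G d) : ℝ :=
  ∑ i, (α * (∫ t in (0 : ℝ)..1, ‖𝒩.curvature i t‖ ^ 2 * ‖d1 (𝒩.curve i) t‖)
    + β * curveLength (𝒩.curve i))

open Classical in
/-- The extended functional: the elastic energy on degenerate networks, `+∞` on the others. -/
def relaxedEnergy [Fintype ι] (α β : ℝ) (D : Directions ι d) (𝒩 : Network G d) : EReal :=
  if 𝒩.InCDeg D then ((𝒩.energy α β : ℝ) : EReal) else ⊤

/-- Strong `H²`-convergence of networks with the same graph: every sequence of curves converges in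
`H²(0,1)`, up to reparametrization of its members and of the limit curve. -/
def TendstoH2 (𝒩s : ℕ → Network G d) (𝒩 : Network G d) : Prop :=
  ∀ i : ι, ∃ (φ : ℕ → ℝ → ℝ) (ψ : ℝ → ℝ), (∀ n, IsReparam (φ n)) ∧ IsReparam ψ ∧
    Tendsto (fun n => h2Norm (fun t => (𝒩s n).curve i (φ n t) - 𝒩.curve i (ψ t))) atTop (𝓝 0)

end Network

end

/-! ### Calculus of $H^2$ curves and of cubic corrections -/

section CurveCalculus

variable {F : Type*} [NormedAddCommGroup F] [NormedSpace ℝ F]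

/-! The strata open the singular edges at separate scales. Each network $\Sigma_j$ gives vertex
positions $\sigma_j$, extended by zero to the other vertices (`exists_vertexMap`). The vertices of
$\mathcal N$ are displaced by $\delta_x=\sum_j x^{2^j}\sigma_j$ with $x\to0$. Let $J$ be the level
at which a singular edge $i$ becomes regular. All earlier levels map $i$ to a point. So the
displaced endpoints differ by $b=x^{2^J}\Delta$, where $\Delta$ is the chord of $i$ in $\Sigma_J$,
plus a remainder $w$. Since $\Sigma_J$ is straight on $i$, $\Delta$ is a positive multiple of the
virtual tangent $\tau^{0,i}$. Since each scale is the square of the preceding one,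
$|w|=O(\varepsilon^2)$ with $\varepsilon=x^{2^J}$ (`InCDeg.exists_displacements`).

Every edge is corrected by the cubic `cubicCurve a b w`, whose velocity at both endpoints is exactly
$b$. A singular edge thus gets the prescribed tangents. Its speed is of order $\varepsilon$ and its
second derivative is $O(\varepsilon^2)$, so its bending energy is
$O(\varepsilon^4/\varepsilon^3)=O(\varepsilon)$ and its length is $O(\varepsilon)$
(`tendsto_energy_cubicCurve`). On a regular edge $b=0$, so the tangents at the endpoints do not
change, and the energy converges by dominated convergence (`IsH2Immersion.tendsto_energy`). All
tangents are those of $\mathcal N$, so the same rotations give the angle condition. -/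

theorem d1_congr {f g : ℝ → F} (h : EqOn f g (Icc 0 1)) : EqOn (d1 f) (d1 g) (Icc 0 1) :=
  fun _ ht => derivWithin_congr h (h ht)

theorem d2_congr {f g : ℝ → F} (h : EqOn f g (Icc 0 1)) : EqOn (d2 f) (d2 g) (Icc 0 1) :=
  d1_congr (d1_congr h)

theorem uniqueDiffWithinAt_unitInterval {t : ℝ} (ht : t ∈ Icc (0 : ℝ) 1) :
    UniqueDiffWithinAt ℝ (Icc (0 : ℝ) 1) t :=
  uniqueDiffOn_Icc one_pos t ht

theorem AbsolutelyContinuousOnInterval.congr {X : Type*} [PseudoMetricSpace X] {f g : ℝ → X}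
    {a b : ℝ} (hf : AbsolutelyContinuousOnInterval f a b) (h : EqOn f g (uIcc a b)) :
    AbsolutelyContinuousOnInterval g a b := by
  rw [absolutelyContinuousOnInterval_iff] at hf ⊢
  intro ε hε
  obtain ⟨δ, hδ, H⟩ := hf ε hε
  refine ⟨δ, hδ, fun E hE hE' => ?_⟩
  convert H E hE hE' using 1
  refine Finset.sum_congr rfl fun i hi => ?_
  have := hE.1 i hi
  rw [h this.1, h this.2]

/-- The cubic curve with value `a`, velocity `b` at `0` and value `a + b + w`, velocity `b`
at `1`. -/
noncomputable def cubicCurve (a b w : F) (t : ℝ) : F := a + t • b + (3 * t ^ 2 - 2 * t ^ 3) • w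

theorem hasDerivAt_cubicCurve (a b w : F) (t : ℝ) :
    HasDerivAt (cubicCurve a b w) (b + (6 * t - 6 * t ^ 2) • w) t := by
  have h1 : HasDerivAt (fun s : ℝ => 3 * s ^ 2 - 2 * s ^ 3) (6 * t - 6 * t ^ 2) t := by
    convert! ((hasDerivAt_pow 2 t).const_mul 3).sub ((hasDerivAt_pow 3 t).const_mul 2) using 1
    norm_num; ring
  have h2 := (((hasDerivAt_id t).smul_const b).const_add a).add (h1.smul_const w)
  simpa [cubicCurve] using! h2

theorem hasDerivAt_cubicCurve_velocity (b w : F) (t : ℝ) :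
    HasDerivAt (fun s : ℝ => b + (6 * s - 6 * s ^ 2) • w) ((6 - 12 * t) • w) t := by
  have h1 : HasDerivAt (fun s : ℝ => 6 * s - 6 * s ^ 2) (6 - 12 * t) t := by
    convert! ((hasDerivAt_id t).const_mul 6).sub ((hasDerivAt_pow 2 t).const_mul 6) using 1
    norm_num; ring
  exact (h1.smul_const w).const_add b

theorem d1_add_cubicCurve {f : ℝ → F} (hf : DifferentiableOn ℝ f (Icc 0 1)) (a b w : F) {t : ℝ}
    (ht : t ∈ Icc (0 : ℝ) 1) :
    d1 (fun s => f s + cubicCurve a b w s) t = d1 f t + (b + (6 * t - 6 * t ^ 2) • w) :=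
  ((hf t ht).hasDerivWithinAt.add (hasDerivAt_cubicCurve a b w t).hasDerivWithinAt).derivWithin
    (uniqueDiffWithinAt_unitInterval ht)

theorem d2_add_cubicCurve {f : ℝ → F} (hf : DifferentiableOn ℝ f (Icc 0 1)) (a b w : F) {t : ℝ}
    (ht : t ∈ Icc (0 : ℝ) 1) (hf' : DifferentiableWithinAt ℝ (d1 f) (Icc 0 1) t) :
    d2 (fun s => f s + cubicCurve a b w s) t = d2 f t + (6 - 12 * t) • w := by
  have h : EqOn (d1 fun s => f s + cubicCurve a b w s)
      (fun s => d1 f s + (b + (6 * s - 6 * s ^ 2) • w)) (Icc 0 1) :=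
    fun s hs => d1_add_cubicCurve hf a b w hs
  refine (d1_congr h ht).trans ?_
  exact (hf'.hasDerivWithinAt.add (hasDerivAt_cubicCurve_velocity b w t).hasDerivWithinAt).derivWithin
    (uniqueDiffWithinAt_unitInterval ht)

theorem d1_const (c : F) : d1 (fun _ => c) = 0 := by
  ext t; simp [d1]

theorem d1_cubicCurve (a b w : F) {t : ℝ} (ht : t ∈ Icc (0 : ℝ) 1) :
    d1 (cubicCurve a b w) t = b + (6 * t - 6 * t ^ 2) • w :=
  (hasDerivAt_cubicCurve a b w t).hasDerivWithinAt.derivWithin (uniqueDiffWithinAt_unitInterval ht)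

theorem d2_cubicCurve (a b w : F) {t : ℝ} (ht : t ∈ Icc (0 : ℝ) 1) :
    d2 (cubicCurve a b w) t = (6 - 12 * t) • w :=
  (d1_congr (fun _ => d1_cubicCurve a b w) ht).trans
    ((hasDerivAt_cubicCurve_velocity b w t).hasDerivWithinAt.derivWithin
      (uniqueDiffWithinAt_unitInterval ht))

theorem norm_cubicCurve_le (a b w : F) {t : ℝ} (ht : t ∈ Icc (0 : ℝ) 1) :
    ‖cubicCurve a b w t‖ ≤ ‖a‖ + ‖b‖ + ‖w‖ := by
  obtain ⟨h0, h1⟩ := ht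
  have hs : |3 * t ^ 2 - 2 * t ^ 3| ≤ 1 := by
    rw [abs_le]
    constructor
    · nlinarith [mul_nonneg (sq_nonneg t) (sub_nonneg.2 h1), sq_nonneg t]
    · nlinarith [mul_nonneg (sq_nonneg (1 - t)) h0, sq_nonneg (1 - t)]
  unfold cubicCurve
  refine (norm_add₃_le).trans ?_
  rw [norm_smul, norm_smul, Real.norm_eq_abs, Real.norm_eq_abs, abs_of_nonneg h0]
  gcongr
  · exact mul_le_of_le_one_left (norm_nonneg _) h1
  · exact mul_le_of_le_one_left (norm_nonneg _) hs

theorem norm_cubicCurve_velocity_le (w : F) {t : ℝ} (ht : t ∈ Icc (0 : ℝ) 1) :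
    ‖(6 * t - 6 * t ^ 2) • w‖ ≤ 2 * ‖w‖ := by
  obtain ⟨h0, h1⟩ := ht
  rw [norm_smul, Real.norm_eq_abs]
  gcongr
  rw [abs_le]
  constructor <;> nlinarith [sq_nonneg (2 * t - 1), mul_nonneg h0 (sub_nonneg.2 h1)]

theorem norm_cubicCurve_acceleration_le (w : F) {t : ℝ} (ht : t ∈ Icc (0 : ℝ) 1) :
    ‖(6 - 12 * t) • w‖ ≤ 6 * ‖w‖ := by
  obtain ⟨h0, h1⟩ := ht
  rw [norm_smul, Real.norm_eq_abs]
  gcongr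
  rw [abs_le]
  constructor <;> linarith

theorem contDiff_cubicCurve (a b w : F) {n : WithTop ℕ∞} : ContDiff ℝ n (cubicCurve a b w) := by
  unfold cubicCurve; fun_prop

theorem IsH2.differentiableOn {f : ℝ → F} (hf : IsH2 f) : DifferentiableOn ℝ f (Icc 0 1) :=
  hf.contDiffOn.differentiableOn one_ne_zero

theorem IsH2.continuousOn_d1 {f : ℝ → F} (hf : IsH2 f) : ContinuousOn (d1 f) (Icc 0 1) :=
  hf.contDiffOn.continuousOn_derivWithin (uniqueDiffOn_Icc one_pos) le_rfl

/-- Absolute continuity gives bounded variation, hence differentiability almost everywhere. This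
makes `d2` additive almost everywhere. -/
theorem IsH2.ae_differentiableWithinAt_d1 [FiniteDimensional ℝ F] {f : ℝ → F} (hf : IsH2 f) :
    ∀ᵐ t ∂volume.restrict (Icc (0 : ℝ) 1), DifferentiableWithinAt ℝ (d1 f) (Icc 0 1) t := by
  have h := hf.absCont.boundedVariationOn
  rw [uIcc_of_le zero_le_one] at h
  exact h.locallyBoundedVariationOn.ae_differentiableWithinAt measurableSet_Icc

theorem IsH2.congr {f g : ℝ → F} (hf : IsH2 f) (h : EqOn g f (Icc 0 1)) : IsH2 g where
  contDiffOn := hf.contDiffOn.congr h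
  absCont := hf.absCont.congr (by
    rw [uIcc_of_le zero_le_one]; exact (d1_congr h).symm)
  memLp := (memLp_congr_ae (by
    filter_upwards [ae_restrict_mem measurableSet_Icc] with t ht using d2_congr h ht)).2 hf.memLp

theorem isH2_cubicCurve (a b w : F) : IsH2 (cubicCurve a b w) where
  contDiffOn := (contDiff_cubicCurve a b w).contDiffOn
  absCont := by
    have h : AbsolutelyContinuousOnInterval (fun s : ℝ => b + (6 * s - 6 * s ^ 2) • w) 0 1 := by
      apply ContDiffOn.absolutelyContinuousOnInterval
      fun_prop
    refine h.congr ?_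
    rw [uIcc_of_le zero_le_one]
    exact fun t ht => (d1_cubicCurve a b w ht).symm
  memLp := by
    refine (memLp_congr_ae (g := fun t : ℝ => (6 - 12 * t) • w) ?_).2 ?_
    · filter_upwards [ae_restrict_mem measurableSet_Icc] with t ht using d2_cubicCurve a b w ht
    · refine MemLp.of_bound (by fun_prop) (6 * ‖w‖) ?_
      filter_upwards [ae_restrict_mem measurableSet_Icc] with t ht
        using norm_cubicCurve_acceleration_le w ht

theorem IsH2.add_cubicCurve [FiniteDimensional ℝ F] {f : ℝ → F} (hf : IsH2 f) (a b w : F) :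
    IsH2 (fun t => f t + cubicCurve a b w t) where
  contDiffOn := hf.contDiffOn.add (contDiff_cubicCurve a b w).contDiffOn
  absCont := by
    refine (hf.absCont.add (isH2_cubicCurve a b w).absCont).congr ?_
    rw [uIcc_of_le zero_le_one]
    intro t ht
    simp [d1_cubicCurve a b w ht, d1_add_cubicCurve hf.differentiableOn a b w ht]
  memLp := by
    refine (memLp_congr_ae ?_).2 (hf.memLp.add (isH2_cubicCurve a b w).memLp)
    filter_upwards [ae_restrict_mem measurableSet_Icc, hf.ae_differentiableWithinAt_d1]
      with t ht hd
    simp [d2_cubicCurve a b w ht, d2_add_cubicCurve hf.differentiableOn a b w ht hd]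

theorem IsConstantCurve.isH2 {f : ℝ → F} (hf : IsConstantCurve f) : IsH2 f := by
  obtain ⟨c, hc⟩ := hf
  refine (isH2_cubicCurve c 0 0).congr fun t ht => ?_
  simp [hc t ht, cubicCurve]

theorem isReparam_id : IsReparam (fun t => t) where
  isH2 := (isH2_cubicCurve (0 : ℝ) 1 0).congr fun t _ => by simp [cubicCurve]
  map_zero := rfl
  map_one := rfl
  deriv_pos t ht := by
    have h : EqOn (fun t : ℝ => t) (cubicCurve (0 : ℝ) 1 0) (Icc 0 1) :=
      fun t _ => by simp [cubicCurve]
    rw [d1_congr h ht, d1_cubicCurve _ _ _ ht]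
    simp

theorem IsH2Immersion.not_isConstantCurve {f : ℝ → F} (hf : IsH2Immersion f) :
    ¬ IsConstantCurve f := by
  rintro ⟨c, hc⟩
  refine hf.2 0 (by simp) ?_
  rw [d1_congr (g := fun _ => c) hc (by simp), d1_const]
  rfl

theorem h2Norm_congr {f g : ℝ → F} (h : EqOn f g (Icc 0 1)) : h2Norm f = h2Norm g := by
  have H : ∀ {u v : ℝ → F}, EqOn u v (Icc 0 1) →
      eLpNorm u 2 (volume.restrict (Icc (0 : ℝ) 1)) =
        eLpNorm v 2 (volume.restrict (Icc (0 : ℝ) 1)) := fun huv =>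
    eLpNorm_congr_ae (by
      filter_upwards [ae_restrict_mem measurableSet_Icc] with t ht using huv ht)
  simp only [h2Norm, H h, H (d1_congr h), H (d2_congr h)]

/-- The cubic and its first two derivatives are bounded on $[0,1]$ by $\|a\|+\|b\|+6\|w\|$, and the
interval has measure one. -/
theorem tendsto_h2Norm_cubicCurve {ι : Type*} {l : Filter ι} {a b w : ι → F}
    (ha : Tendsto a l (𝓝 0)) (hb : Tendsto b l (𝓝 0)) (hw : Tendsto w l (𝓝 0)) :
    Tendsto (fun n => h2Norm (cubicCurve (a n) (b n) (w n))) l (𝓝 0) := by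
  have H : ∀ (u : ι → ℝ → F), (∀ n, ∀ t ∈ Icc (0 : ℝ) 1,
      ‖u n t‖ ≤ ‖a n‖ + ‖b n‖ + 6 * ‖w n‖) →
      Tendsto (fun n => eLpNorm (u n) 2 (volume.restrict (Icc (0 : ℝ) 1)) ^ 2) l (𝓝 0) := by
    intro u hu
    have h1 : Tendsto (fun n => ENNReal.ofReal (‖a n‖ + ‖b n‖ + 6 * ‖w n‖)) l (𝓝 0) := by
      have := (ha.norm.add hb.norm).add (hw.norm.const_mul 6)
      simpa using ENNReal.tendsto_ofReal this
    have h2 : Tendsto (fun n => eLpNorm (u n) 2 (volume.restrict (Icc (0 : ℝ) 1))) l (𝓝 0) := by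
      refine tendsto_of_tendsto_of_tendsto_of_le_of_le tendsto_const_nhds h1
        (fun _ => zero_le) fun n => ?_
      refine (eLpNorm_le_of_ae_bound (C := ‖a n‖ + ‖b n‖ + 6 * ‖w n‖) ?_).trans ?_
      · filter_upwards [ae_restrict_mem measurableSet_Icc] with t ht using hu n t ht
      · simp
    have h3 := ENNReal.Tendsto.pow (n := 2) h2
    simpa using h3
  have h := ((H (fun n => cubicCurve (a n) (b n) (w n)) fun n t ht => ?_).add
    (H (fun n => d1 (cubicCurve (a n) (b n) (w n))) fun n t ht => ?_)).add
    (H (fun n => d2 (cubicCurve (a n) (b n) (w n))) fun n t ht => ?_)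
  · have h' := (ENNReal.continuous_rpow_const (y := (1 / 2 : ℝ))).tendsto (0 + 0 + 0) |>.comp h
    simpa [h2Norm, Function.comp_def] using h'
  · linarith [norm_cubicCurve_le (a n) (b n) (w n) ht, norm_nonneg (w n)]
  · rw [d1_cubicCurve _ _ _ ht]
    linarith [norm_add_le (b n) ((6 * t - 6 * t ^ 2) • w n), norm_cubicCurve_velocity_le (w n) ht,
      norm_nonneg (a n), norm_nonneg (w n)]
  · rw [d2_cubicCurve _ _ _ ht]
    linarith [norm_cubicCurve_acceleration_le (w n) ht, norm_nonneg (a n), norm_nonneg (b n)]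

end CurveCalculus

/-! ### Tangents at the endpoints and straight segments -/

section Tangents

variable {F : Type*} [NormedAddCommGroup F] [NormedSpace ℝ F]

/-- The factor $6t-6t^2$ of $w$ vanishes at both endpoints. -/
theorem d1_add_cubicCurve_endParam {f : ℝ → F} (hf : DifferentiableOn ℝ f (Icc 0 1)) (a b w : F)
    (z : Fin 2) :
    d1 (fun s => f s + cubicCurve a b w s) (endParam z) = d1 f (endParam z) + b := by
  rw [d1_add_cubicCurve hf a b w (endParam z).2]
  fin_cases z <;> simp [endParam]

/-- Difference quotients at $0$ are nonnegative multiples of the chord, and lying on a common ray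
with the chord is a closed condition. The curve need not be monotone along the segment. -/
theorem SameRay.of_isStraightSegment {γ : ℝ → F} (hγ : DifferentiableOn ℝ γ (Icc 0 1))
    (hs : IsStraightSegment γ) : SameRay ℝ (γ 1 - γ 0) (d1 γ 0) := by
  have h0 : (0 : ℝ) ∈ Icc (0 : ℝ) 1 := by simp
  have hd : HasDerivWithinAt γ (d1 γ 0) (Icc 0 1) 0 := (hγ 0 h0).hasDerivWithinAt
  rw [hasDerivWithinAt_iff_tendsto_slope] at hd
  have hne : (𝓝[Icc (0 : ℝ) 1 \ {0}] 0).NeBot := by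
    have : Ioc (0 : ℝ) 1 ⊆ Icc (0 : ℝ) 1 \ {0} := fun t ht =>
      ⟨Ioc_subset_Icc_self ht, ht.1.ne'⟩
    exact (left_nhdsWithin_Ioc_neBot one_pos).mono (nhdsWithin_mono _ this)
  have hclosed : IsClosed {x : F | SameRay ℝ (γ 1 - γ 0) x} := by
    simp only [sameRay_iff_norm_smul_eq]
    exact isClosed_eq (by fun_prop) (by fun_prop)
  refine hclosed.mem_of_tendsto hd ?_
  filter_upwards [self_mem_nhdsWithin] with t ht
  have hmem : γ t ∈ segment ℝ (γ 0) (γ 1) := hs ▸ mem_image_of_mem γ ht.1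
  rw [segment_eq_image'] at hmem
  obtain ⟨θ, hθ, hθ'⟩ := hmem
  have : slope γ 0 t = (t⁻¹ * θ) • (γ 1 - γ 0) := by
    rw [slope_def_module, ← hθ', sub_zero, add_sub_cancel_left, smul_smul]
  change SameRay ℝ (γ 1 - γ 0) (slope γ 0 t)
  rw [this]
  exact SameRay.sameRay_nonneg_smul_right _ (mul_nonneg (inv_nonneg.2 ht.1.1) hθ.1)

theorem IsStraightSegment.ne {γ : ℝ → F} (hs : IsStraightSegment γ) (hc : ¬ IsConstantCurve γ) :
    γ 1 - γ 0 ≠ 0 := by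
  intro h
  refine hc ⟨γ 0, fun t ht => ?_⟩
  have hmem : γ t ∈ segment ℝ (γ 0) (γ 1) := hs ▸ mem_image_of_mem γ ht
  rwa [sub_eq_zero.1 h, segment_same] at hmem

theorem outerTangent_zero_eq_of_isStraightSegment {γ : ℝ → F} (hγ : IsH2Immersion γ)
    (hs : IsStraightSegment γ) : outerTangent γ 0 = ‖γ 1 - γ 0‖⁻¹ • (γ 1 - γ 0) := by
  have h := (sameRay_iff_inv_norm_smul_eq_of_ne (hs.ne hγ.not_isConstantCurve)
    (hγ.2 0 (by simp))).1 (SameRay.of_isStraightSegment hγ.1.differentiableOn hs)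
  simp [outerTangent, endParam, h]

end Tangents

/-! ### Convergence of bending energy and length -/

section Energy

variable {d : ℕ}

/-- The integrand `|k|² ds/dt` of the bending energy. -/
noncomputable def bendingDensity (γ : ℝ → Euc d) (t : ℝ) : ℝ := ‖curvatureVec γ t‖ ^ 2 * ‖d1 γ t‖

theorem bendingDensity_nonneg (γ : ℝ → Euc d) (t : ℝ) : 0 ≤ bendingDensity γ t := by
  unfold bendingDensity; positivity

theorem norm_curvatureVec_le (γ : ℝ → Euc d) (t : ℝ) :
    ‖curvatureVec γ t‖ ≤ 2 * ‖d2 γ t‖ / ‖d1 γ t‖ ^ 2 := by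
  unfold curvatureVec
  rcases eq_or_ne (d1 γ t) 0 with h | h
  · simp [h]
  have hx : 0 < ‖d1 γ t‖ := norm_pos_iff.2 h
  refine (norm_sub_le _ _).trans ?_
  rw [norm_smul, norm_smul, norm_div, norm_div, norm_pow, norm_pow, norm_norm, norm_one]
  have h1 : ‖inner ℝ (d2 γ t) (d1 γ t)‖ / ‖d1 γ t‖ ^ 4 * ‖d1 γ t‖
      ≤ ‖d2 γ t‖ * ‖d1 γ t‖ / ‖d1 γ t‖ ^ 4 * ‖d1 γ t‖ := by
    gcongr; exact norm_inner_le_norm _ _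
  have h2 : ‖d2 γ t‖ * ‖d1 γ t‖ / ‖d1 γ t‖ ^ 4 * ‖d1 γ t‖ = ‖d2 γ t‖ / ‖d1 γ t‖ ^ 2 := by
    field_simp
  calc _ ≤ 1 / ‖d1 γ t‖ ^ 2 * ‖d2 γ t‖ + ‖d2 γ t‖ / ‖d1 γ t‖ ^ 2 := by rw [← h2]; gcongr
    _ = _ := by ring

theorem bendingDensity_le {γ : ℝ → Euc d} {t m : ℝ} (hm : 0 < m) (h : m ≤ ‖d1 γ t‖) :
    bendingDensity γ t ≤ 4 * ‖d2 γ t‖ ^ 2 / m ^ 3 := by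
  have hx : 0 < ‖d1 γ t‖ := hm.trans_le h
  calc bendingDensity γ t ≤ (2 * ‖d2 γ t‖ / ‖d1 γ t‖ ^ 2) ^ 2 * ‖d1 γ t‖ := by
        unfold bendingDensity; gcongr; exact norm_curvatureVec_le γ t
    _ = 4 * ‖d2 γ t‖ ^ 2 / ‖d1 γ t‖ ^ 3 := by field_simp; ring
    _ ≤ _ := by gcongr

theorem IsH2.aestronglyMeasurable_bendingDensity {γ : ℝ → Euc d} (hγ : IsH2 γ) :
    AEStronglyMeasurable (bendingDensity γ) (volume.restrict (Icc (0 : ℝ) 1)) := by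
  have h1 : AEMeasurable (d1 γ) (volume.restrict (Icc (0 : ℝ) 1)) :=
    hγ.continuousOn_d1.aemeasurable measurableSet_Icc
  have h2 : AEMeasurable (d2 γ) (volume.restrict (Icc (0 : ℝ) 1)) :=
    hγ.memLp.aestronglyMeasurable.aemeasurable
  apply AEMeasurable.aestronglyMeasurable
  unfold bendingDensity curvatureVec
  fun_prop

theorem IsH2Immersion.exists_le_norm_d1 {γ : ℝ → Euc d} (hγ : IsH2Immersion γ) :
    ∃ m > 0, ∀ t ∈ Icc (0 : ℝ) 1, m ≤ ‖d1 γ t‖ := by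
  obtain ⟨x, hx, hmin⟩ := isCompact_Icc.exists_isMinOn (nonempty_Icc.2 zero_le_one)
    hγ.1.continuousOn_d1.norm
  exact ⟨_, norm_pos_iff.2 (hγ.2 x hx), fun t ht => hmin ht⟩

/-- Bending energy and length of small perturbations of an immersion converge. -/
theorem IsH2Immersion.tendsto_energy {γ : ℝ → Euc d} (hγ : IsH2Immersion γ) {ι : Type*}
    {l : Filter ι} [l.IsCountablyGenerated] (a : ι → Euc d) {w : ι → Euc d}
    (hw : Tendsto w l (𝓝 0)) {η : ι → ℝ → Euc d}
    (hη : ∀ n, EqOn (η n) (fun t => γ t + cubicCurve (a n) 0 (w n) t) (Icc 0 1)) :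
    Tendsto (fun n => ∫ t in (0 : ℝ)..1, bendingDensity (η n) t) l
      (𝓝 (∫ t in (0 : ℝ)..1, bendingDensity γ t)) ∧
    Tendsto (fun n => curveLength (η n)) l (𝓝 (curveLength γ)) ∧
    ∀ᶠ n in l, IsH2Immersion (η n) := by
  have hsub : uIoc (0 : ℝ) 1 ⊆ Icc 0 1 := by
    rw [uIoc_of_le zero_le_one]; exact Ioc_subset_Icc_self
  have hrestrict : volume.restrict (uIoc (0 : ℝ) 1) ≤ volume.restrict (Icc (0 : ℝ) 1) :=
    Measure.restrict_mono hsub le_rfl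
  have hH2 : ∀ n, IsH2 (η n) := fun n => (hγ.1.add_cubicCurve _ _ _).congr (hη n)
  have hd1 : ∀ n, ∀ t ∈ Icc (0 : ℝ) 1, d1 (η n) t = d1 γ t + (6 * t - 6 * t ^ 2) • w n := by
    intro n t ht
    rw [d1_congr (hη n) ht, d1_add_cubicCurve hγ.1.differentiableOn _ _ _ ht, zero_add]
  have hd2 : ∀ n, ∀ t ∈ Icc (0 : ℝ) 1, DifferentiableWithinAt ℝ (d1 γ) (Icc 0 1) t →
      d2 (η n) t = d2 γ t + (6 - 12 * t) • w n := by
    intro n t ht hd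
    rw [d2_congr (hη n) ht, d2_add_cubicCurve hγ.1.differentiableOn _ _ _ ht hd]
  have td1 : ∀ t ∈ Icc (0 : ℝ) 1, Tendsto (fun n => d1 (η n) t) l (𝓝 (d1 γ t)) := by
    intro t ht
    simp only [hd1 _ t ht]
    have := (hw.const_smul (6 * t - 6 * t ^ 2)).const_add (d1 γ t)
    rwa [smul_zero, add_zero] at this
  have td2 : ∀ t ∈ Icc (0 : ℝ) 1, DifferentiableWithinAt ℝ (d1 γ) (Icc 0 1) t →
      Tendsto (fun n => d2 (η n) t) l (𝓝 (d2 γ t)) := by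
    intro t ht hd
    simp only [hd2 _ t ht hd]
    simpa using (hw.const_smul (6 - 12 * t)).const_add (d2 γ t)
  have hae : ∀ᵐ t, t ∈ uIoc (0 : ℝ) 1 → DifferentiableWithinAt ℝ (d1 γ) (Icc 0 1) t := by
    filter_upwards [(ae_restrict_iff' measurableSet_Icc).1 hγ.1.ae_differentiableWithinAt_d1]
      with t ht ht' using ht (hsub ht')
  obtain ⟨m, hm, hmle⟩ := hγ.exists_le_norm_d1
  -- The bound $m/4$ keeps the speed above $m/2$, as the velocity changes by at most $2\|w\|$; the
  -- bound $1$ serves the dominating functions.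
  have hwsmall : ∀ᶠ n in l, ‖w n‖ < min 1 (m / 4) :=
    (tendsto_zero_iff_norm_tendsto_zero.1 hw).eventually_lt_const (by positivity)
  have hlow : ∀ᶠ n in l, ∀ t ∈ Icc (0 : ℝ) 1, m / 2 ≤ ‖d1 (η n) t‖ := by
    filter_upwards [hwsmall] with n hn t ht
    have h1 := norm_cubicCurve_velocity_le (w n) ht
    have h2 := norm_sub_le (d1 (η n) t) ((6 * t - 6 * t ^ 2) • w n)
    rw [hd1 n t ht, add_sub_cancel_right] at h2
    rw [hd1 n t ht]
    have h3 := hmle t ht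
    have h4 := hn.trans_le (min_le_right _ _)
    linarith
  refine ⟨?_, ?_, ?_⟩
  -- With $\|w\|<1$ the second derivative is at most $\|\gamma''\|+6$, and $(y+6)^2\le 2y^2+72$.
  · refine intervalIntegral.tendsto_integral_filter_of_dominated_convergence
      (fun t => 4 * (2 * ‖d2 γ t‖ ^ 2 + 72) / (m / 2) ^ 3) ?_ ?_ ?_ ?_
    · exact Eventually.of_forall fun n => (hH2 n).aestronglyMeasurable_bendingDensity.mono_measure hrestrict
    · filter_upwards [hlow, hwsmall] with n hn hw1
      filter_upwards [hae] with t ht ht'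
      rw [Real.norm_of_nonneg (bendingDensity_nonneg _ _)]
      refine (bendingDensity_le (by positivity) (hn t (hsub ht'))).trans ?_
      gcongr
      have h1 := norm_cubicCurve_acceleration_le (w n) (hsub ht')
      have h2 := norm_add_le (d2 γ t) ((6 - 12 * t) • w n)
      rw [hd2 n t (hsub ht') (ht ht')]
      have h3 := hw1.trans_le (min_le_left _ _)
      have h4 : ‖d2 γ t + (6 - 12 * t) • w n‖ ≤ ‖d2 γ t‖ + 6 := by linarith
      calc _ ≤ (‖d2 γ t‖ + 6) ^ 2 := by gcongr
        _ ≤ _ := by nlinarith [sq_nonneg (‖d2 γ t‖ - 6)]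
    · have h : Integrable (fun t => ‖d2 γ t‖ ^ 2) (volume.restrict (uIoc (0 : ℝ) 1)) :=
        (hγ.1.memLp.integrable_norm_pow two_ne_zero).mono_measure hrestrict
      rw [intervalIntegrable_iff]
      have : IsFiniteMeasure (volume.restrict (uIoc (0 : ℝ) 1)) := by
        rw [uIoc_of_le zero_le_one]; infer_instance
      exact (((h.const_mul 2).add (integrable_const 72)).const_mul 4).div_const _
    · filter_upwards [hae] with t ht ht'
      have h1 := td1 t (hsub ht')
      have h2 := td2 t (hsub ht') (ht ht')
      have hne : ‖d1 γ t‖ ≠ 0 := norm_ne_zero_iff.2 (hγ.2 t (hsub ht'))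
      unfold bendingDensity curvatureVec
      exact (((((tendsto_const_nhds.div (h1.norm.pow 2) (pow_ne_zero 2 hne)).smul h2).sub
        (((h2.inner h1).div (h1.norm.pow 4) (pow_ne_zero 4 hne)).smul h1)).norm.pow 2).mul h1.norm)
  · refine intervalIntegral.tendsto_integral_filter_of_dominated_convergence
      (fun t => ‖d1 γ t‖ + 2) ?_ ?_ ?_ ?_
    · exact Eventually.of_forall fun n => ((hH2 n).continuousOn_d1.norm.aestronglyMeasurable
        measurableSet_Icc).mono_measure hrestrict
    · filter_upwards [hwsmall] with n hw1
      refine Eventually.of_forall fun t ht' => ?_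
      rw [norm_norm, hd1 n t (hsub ht')]
      have h1 := norm_cubicCurve_velocity_le (w n) (hsub ht')
      have h2 := norm_add_le (d1 γ t) ((6 * t - 6 * t ^ 2) • w n)
      have h3 := hw1.trans_le (min_le_left _ _)
      linarith
    · apply ContinuousOn.intervalIntegrable
      rw [uIcc_of_le zero_le_one]
      exact hγ.1.continuousOn_d1.norm.add continuousOn_const
    · exact Eventually.of_forall fun t ht' => (td1 t (hsub ht')).norm
  · filter_upwards [hlow] with n hn
    refine ⟨hH2 n, fun t ht h => ?_⟩
    have := hn t ht
    rw [h, norm_zero] at this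
    linarith

/-- Bending energy and length of short, almost straight cubic curves tend to zero. -/
theorem tendsto_energy_cubicCurve {ι : Type*} {l : Filter ι} {a b w : ι → Euc d} {c C : ℝ}
    {ε : ι → ℝ} (hc : 0 < c) (hε0 : ∀ n, 0 < ε n) (hε : Tendsto ε l (𝓝 0))
    (hb : ∀ n, ‖b n‖ = c * ε n) (hw : ∀ n, ‖w n‖ ≤ C * ε n ^ 2)
    {η : ι → ℝ → Euc d} (hη : ∀ n, EqOn (η n) (cubicCurve (a n) (b n) (w n)) (Icc 0 1)) :
    Tendsto (fun n => ∫ t in (0 : ℝ)..1, bendingDensity (η n) t) l (𝓝 0) ∧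
    Tendsto (fun n => curveLength (η n)) l (𝓝 0) ∧
    ∀ᶠ n in l, IsH2Immersion (η n) := by
  have hsub : uIoc (0 : ℝ) 1 ⊆ Icc 0 1 := by
    rw [uIoc_of_le zero_le_one]; exact Ioc_subset_Icc_self
  have hd1 : ∀ n, ∀ t ∈ Icc (0 : ℝ) 1, d1 (η n) t = b n + (6 * t - 6 * t ^ 2) • w n :=
    fun n t ht => by rw [d1_congr (hη n) ht, d1_cubicCurve _ _ _ ht]
  have hd2 : ∀ n, ∀ t ∈ Icc (0 : ℝ) 1, d2 (η n) t = (6 - 12 * t) • w n :=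
    fun n t ht => by rw [d2_congr (hη n) ht, d2_cubicCurve _ _ _ ht]
  -- Then the velocity perturbation $2C\varepsilon^2$ is below $c\varepsilon/2$, half of the speed
  -- $\|b\|$.
  have hsmall : ∀ᶠ n in l, 4 * C * ε n < c := by
    have := hε.const_mul (4 * C)
    rw [mul_zero] at this
    exact this.eventually_lt_const hc
  have hlow : ∀ᶠ n in l, ∀ t ∈ Icc (0 : ℝ) 1, c / 2 * ε n ≤ ‖d1 (η n) t‖ := by
    filter_upwards [hsmall] with n hn t ht
    have h1 := norm_cubicCurve_velocity_le (w n) ht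
    have h2 := norm_sub_le (d1 (η n) t) ((6 * t - 6 * t ^ 2) • w n)
    rw [hd1 n t ht, add_sub_cancel_right] at h2
    rw [hd1 n t ht]
    have h3 := hw n
    nlinarith [hε0 n, hb n]
  refine ⟨?_, ?_, ?_⟩
  -- $1152=4\cdot 6^2\cdot 2^3$, from $4(6C\varepsilon^2)^2/(c\varepsilon/2)^3$.
  · have hz : Tendsto (fun n => 1152 * C ^ 2 / c ^ 3 * ε n) l (𝓝 0) := by
      simpa using hε.const_mul (1152 * C ^ 2 / c ^ 3)
    refine squeeze_zero_norm' ?_ hz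
    filter_upwards [hlow] with n hn
    have := intervalIntegral.norm_integral_le_of_norm_le_const (a := (0 : ℝ)) (b := 1)
      (f := bendingDensity (η n)) (C := 1152 * C ^ 2 / c ^ 3 * ε n) fun t ht => ?_
    · simpa using this
    rw [Real.norm_of_nonneg (bendingDensity_nonneg _ _)]
    have hpos := hε0 n
    refine (bendingDensity_le (by positivity) (hn t (hsub ht))).trans ?_
    have h1 := norm_cubicCurve_acceleration_le (w n) (hsub ht)
    rw [hd2 n t (hsub ht)]
    have h3 := hw n
    calc 4 * ‖(6 - 12 * t) • w n‖ ^ 2 / (c / 2 * ε n) ^ 3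
        ≤ 4 * (6 * (C * ε n ^ 2)) ^ 2 / (c / 2 * ε n) ^ 3 := by gcongr; linarith
      _ = _ := by field_simp; ring
  · have hz : Tendsto (fun n => c * ε n + 2 * (C * ε n ^ 2)) l (𝓝 0) := by
      simpa using (hε.const_mul c).add (((hε.pow 2).const_mul C).const_mul 2)
    refine squeeze_zero_norm' (Eventually.of_forall fun n => ?_) hz
    have := intervalIntegral.norm_integral_le_of_norm_le_const (a := (0 : ℝ)) (b := 1)
      (f := fun t => ‖d1 (η n) t‖) (C := c * ε n + 2 * (C * ε n ^ 2)) fun t ht => ?_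
    · simpa [curveLength] using this
    rw [norm_norm, hd1 n t (hsub ht)]
    have h1 := norm_cubicCurve_velocity_le (w n) (hsub ht)
    have h2 := norm_add_le (b n) ((6 * t - 6 * t ^ 2) • w n)
    have h3 := hw n
    linarith [hb n]
  · filter_upwards [hlow] with n hn
    refine ⟨(isH2_cubicCurve _ _ _).congr (hη n), fun t ht h => ?_⟩
    have := hn t ht
    rw [h, norm_zero] at this
    have := mul_pos (half_pos hc) (hε0 n)
    linarith

end Energy

theorem IsH2Immersion.congr {F : Type*} [NormedAddCommGroup F] [NormedSpace ℝ F] {f g : ℝ → F}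
    (hf : IsH2Immersion f) (h : EqOn g f (Icc 0 1)) : IsH2Immersion g :=
  ⟨hf.1.congr h, fun t ht => by rw [d1_congr h ht]; exact hf.2 t ht⟩

/-! ### Vertex displacements and corrected networks -/

namespace Network

variable {ι : Type} {G : NGraph ι} {d : ℕ}

theorem curve_apply (𝒩 : Network G d) (i : ι) (t : unitInterval) :
    𝒩.curve i t = 𝒩.Γ (Quot.mk G.glue ⟨i, t⟩) :=
  IccExtend_val _ _ t

theorem isH2Immersion_of_notMem_sing (𝒩 : Network G d) {i : ι} (hi : i ∉ 𝒩.sing) :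
    IsH2Immersion (𝒩.curve i) :=
  (𝒩.curve_spec i).resolve_left hi

theorem isH2_curve (𝒩 : Network G d) (i : ι) : IsH2 (𝒩.curve i) :=
  (𝒩.curve_spec i).elim IsConstantCurve.isH2 And.left

/-- The chosen endpoint does not matter, since the subgraph inherits the identifications of `G`. -/
theorem exists_vertexMap {H : Set ι} (S : Network (G.sub H) d) :
    ∃ σ : G.Vertex → Euc d, ∀ (z : Fin 2) (i : H),
      σ (G.proj (z, i)) = S.curve i (endParam z) := by
  classical
  refine ⟨fun p => if h : ∃ x : Fin 2 × H, G.proj (x.1, x.2) = p then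
    S.curve h.choose.2 (endParam h.choose.1) else 0, fun z i => ?_⟩
  have h : ∃ x : Fin 2 × H, G.proj (x.1, x.2) = G.proj (z, i) := ⟨(z, i), rfl⟩
  simp only [dif_pos h, curve_apply]
  have hr : G.rel (h.choose.1, (h.choose.2 : ι)) (z, (i : ι)) := Quotient.exact h.choose_spec
  exact congrArg S.Γ (Quot.sound ⟨_, _, rfl, rfl, hr⟩)

/-- The correction of the edge `i` that moves the vertices by `δ` and changes the velocities at
both endpoints by `b i`. -/
noncomputable def edgeCorrection (G : NGraph ι) (δ : G.Vertex → Euc d) (b : ι → Euc d) (i : ι) :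
    ℝ → Euc d :=
  cubicCurve (δ (G.proj (0, i))) (b i) (δ (G.proj (1, i)) - δ (G.proj (0, i)) - b i)

theorem edgeCorrection_endParam (δ : G.Vertex → Euc d) (b : ι → Euc d) (i : ι) (z : Fin 2) :
    edgeCorrection G δ b i (endParam z) = δ (G.proj (z, i)) := by
  fin_cases z
  · simp [edgeCorrection, endParam, cubicCurve]
  · simp [edgeCorrection, endParam, cubicCurve]
    norm_num

/-- The correction at an endpoint depends only on its vertex, so the corrected map descends to the
quotient. -/
theorem exists_corrected (𝒩 : Network G d) (δ : G.Vertex → Euc d) (b : ι → Euc d)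
    (h : ∀ i, IsH2Immersion fun t => 𝒩.curve i t + edgeCorrection G δ b i t) :
    ∃ 𝒩' : Network G d, ∀ i,
      EqOn (𝒩'.curve i) (fun t => 𝒩.curve i t + edgeCorrection G δ b i t) (Icc 0 1) := by
  let g : (Σ _ : ι, unitInterval) → Euc d :=
    fun x => 𝒩.Γ (Quot.mk G.glue x) + edgeCorrection G δ b x.1 x.2
  have hg : ∀ x y, G.glue x y → g x = g y := by
    rintro ⟨i, t⟩ ⟨j, s⟩ hxy
    have h1 : Quot.mk G.glue ⟨i, t⟩ = Quot.mk G.glue ⟨j, s⟩ := Quot.sound hxy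
    obtain ⟨z, w, rfl, rfl, hr⟩ := hxy
    have h2 : G.proj (z, i) = G.proj (w, j) := Quotient.sound hr
    simp only [g, h1, edgeCorrection_endParam, h2]
  have hcont : Continuous (Quot.lift g hg) := by
    refine continuous_quot_lift _ ((𝒩.Γ.continuous.comp continuous_quot_mk).add ?_)
    refine continuous_sigma fun i => ?_
    have h : Continuous (edgeCorrection G δ b i) :=
      (contDiff_cubicCurve _ _ _ (n := 0)).continuous
    exact h.comp continuous_subtype_val
  have heq : ∀ i, EqOn (IccExtend (zero_le_one' ℝ) fun t => Quot.lift g hg (Quot.mk G.glue ⟨i, t⟩))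
      (fun t => 𝒩.curve i t + edgeCorrection G δ b i t) (Icc 0 1) := by
    intro i t ht
    simp only [IccExtend_of_mem _ _ ht, curve, g]
  exact ⟨⟨⟨Quot.lift g hg, hcont⟩, fun i => Or.inr ((h i).congr (heq i))⟩, heq⟩

theorem exists_stratum_index {stratum : ℕ → Set ι} {q : ℕ} {i : ι} (h0 : i ∈ stratum 0)
    (hq : stratum q = ∅) : ∃ j < q, (∀ k ≤ j, i ∈ stratum k) ∧ i ∉ stratum (j + 1) := by
  classical
  have hex : ∃ m, i ∉ stratum m := ⟨q, by simp [hq]⟩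
  obtain ⟨j, hj⟩ : ∃ j, Nat.find hex = j + 1 :=
    Nat.exists_eq_succ_of_ne_zero fun h => (h ▸ Nat.find_spec hex) h0
  refine ⟨j, ?_, fun k hk => ?_, hj ▸ Nat.find_spec hex⟩
  · have := Nat.find_min' hex (m := q) (by simp [hq])
    omega
  · exact not_not.1 (Nat.find_min hex (m := k) (by omega))

/-- For a degenerate network there are small vertex displacements, with the leading order on each
singular edge in the direction of its virtual tangent and a remainder of quadratic size. -/
theorem InCDeg.exists_displacements {D : Directions ι d} {𝒩 : Network G d} (h : 𝒩.InCDeg D) :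
    ∃ τ : TangentFamily ι d, 𝒩.AngleConditionWith D τ ∧
    ∃ (δ : ℝ → G.Vertex → Euc d) (b : ℝ → ι → Euc d),
      (∀ p, Tendsto (fun x => δ x p) (𝓝 0) (𝓝 0)) ∧ (∀ i ∉ 𝒩.sing, ∀ x, b x i = 0) ∧
      ∀ i ∈ 𝒩.sing, ∃ (k : ℕ) (c C : ℝ), k ≠ 0 ∧ 0 < c ∧ ∀ x, 0 < x → x ≤ 1 →
        ‖b x i‖ = c * x ^ k ∧ ‖b x i‖⁻¹ • b x i = τ (0, i) ∧
        ‖δ x (G.proj (1, i)) - δ x (G.proj (0, i)) - b x i‖ ≤ C * (x ^ k) ^ 2 := by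
  classical
  obtain ⟨τ, hτ, q, stratum, S, h0, hq, hS⟩ := h
  refine ⟨τ, hτ, ?_⟩
  choose σ hσ using fun j => exists_vertexMap (S j)
  set Δ : ℕ → ι → Euc d := fun j i => σ j (G.proj (1, i)) - σ j (G.proj (0, i)) with hΔ
  have hΔ' : ∀ j (i : stratum j), Δ j i = (S j).curve i 1 - (S j).curve i 0 := by
    intro j i
    simp only [hΔ, hσ]
    simp [endParam]
  have key : ∀ i, ∃ j, i ∈ 𝒩.sing → j < q ∧ (∀ k < j, Δ k i = 0) ∧ Δ j i ≠ 0 ∧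
      ‖Δ j i‖⁻¹ • Δ j i = τ (0, i) := by
    intro i
    by_cases hi : i ∈ 𝒩.sing
    swap
    · exact ⟨0, fun h => absurd h hi⟩
    obtain ⟨j, hjq, hmem, hnot⟩ := exists_stratum_index (h0 ▸ hi) hq
    refine ⟨j, fun _ => ⟨hjq, fun k hk => ?_, ?_⟩⟩
    · have hk' := hmem (k + 1) hk
      rw [(hS k (hk.trans hjq)).2.2] at hk'
      obtain ⟨i', ⟨c, hc⟩, rfl⟩ := hk'
      rw [hΔ' k i', hc 1 (by simp), hc 0 (by simp), sub_self]
    -- At level `j` the edge is regular and straight, so its chord points along its outer tangent,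
    -- which is the prescribed $\tau^{0,i}$.
    · obtain ⟨hang, hstr, hnext⟩ := hS j hjq
      have hns : (⟨i, hmem j le_rfl⟩ : stratum j) ∉ (S j).sing := fun h =>
        hnot (hnext ▸ mem_image_of_mem Subtype.val h)
      have hΔi := hΔ' j ⟨i, hmem j le_rfl⟩
      have ht := hang.real _ hns 0
      rw [outerTangent_zero_eq_of_isStraightSegment (isH2Immersion_of_notMem_sing _ hns)
        (hstr _ hns), ← hΔi] at ht
      exact ⟨hΔi ▸ (hstr _ hns).ne hns, ht.symm⟩
  choose J hJ using key
  refine ⟨fun x p => ∑ j ∈ Finset.range q, x ^ 2 ^ j • σ j p,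
    fun x i => if i ∈ 𝒩.sing then x ^ 2 ^ J i • Δ (J i) i else 0, fun p => ?_,
    fun i hi x => if_neg hi, fun i hi => ?_⟩
  · have hc : Continuous fun x : ℝ => ∑ j ∈ Finset.range q, x ^ 2 ^ j • σ j p := by fun_prop
    simpa using hc.tendsto 0
  obtain ⟨hJq, hlt, hne, hdir⟩ := hJ i hi
  refine ⟨2 ^ J i, ‖Δ (J i) i‖, ∑ j ∈ Finset.range q, ‖Δ j i‖, by positivity,
    norm_pos_iff.2 hne, fun x hx hx1 => ?_⟩
  have hpos : 0 < x ^ 2 ^ J i := by positivity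
  have hnorm : ‖x ^ 2 ^ J i • Δ (J i) i‖ = ‖Δ (J i) i‖ * x ^ 2 ^ J i := by
    rw [norm_smul, Real.norm_of_nonneg hpos.le, mul_comm]
  simp only [if_pos hi]
  refine ⟨hnorm, ?_, ?_⟩
  · rw [hnorm, mul_inv, smul_smul, inv_mul_cancel_right₀ hpos.ne', hdir]
  · rw [← Finset.sum_sub_distrib]
    simp only [← smul_sub]
    have hmem : J i ∈ Finset.range q := Finset.mem_range.2 hJq
    change ‖∑ j ∈ Finset.range q, x ^ 2 ^ j • Δ j i - _‖ ≤ _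
    rw [← Finset.add_sum_erase _ _ hmem, add_sub_cancel_left, Finset.sum_mul]
    refine (norm_sum_le _ _).trans ((Finset.sum_le_sum fun k hk => ?_).trans
      (Finset.sum_le_sum_of_subset_of_nonneg (Finset.erase_subset _ _) fun _ _ _ => by positivity))
    rw [norm_smul, Real.norm_of_nonneg (by positivity), mul_comm]
    -- Levels below $J$ contribute nothing. For $k>J$ one has $x^{2^k}\le x^{2^{J+1}}=(x^{2^J})^2$,
    -- as $x\le1$.
    rcases lt_or_gt_of_ne (Finset.ne_of_mem_erase hk) with hk' | hk'
    · simp [hlt k hk']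
    · gcongr
      rw [← pow_mul, ← pow_succ]
      exact pow_le_pow_of_le_one hx.le hx1 (Nat.pow_le_pow_right two_pos hk')

theorem energy_of_isRegular [Fintype ι] (α β : ℝ) {𝒩 : Network G d} (h : 𝒩.IsRegular) :
    𝒩.energy α β = ∑ i, (α * (∫ t in (0 : ℝ)..1, bendingDensity (𝒩.curve i) t)
      + β * curveLength (𝒩.curve i)) := by
  have hi : ∀ i, i ∉ 𝒩.sing := fun i => by rw [h]; exact notMem_empty i
  simp only [energy, curvature, if_neg (hi _), bendingDensity]

theorem curveLength_of_mem_sing {𝒩 : Network G d} {i : ι} (hi : i ∈ 𝒩.sing) :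
    curveLength (𝒩.curve i) = 0 := by
  obtain ⟨c, hc⟩ := hi
  refine intervalIntegral.integral_zero_ae (Eventually.of_forall fun t ht => ?_)
  rw [uIoc_of_le zero_le_one] at ht
  rw [d1_congr (g := fun _ => c) hc (Ioc_subset_Icc_self ht), d1_const]
  simp

/-- Convergence of the energy of a corrected edge. -/
theorem tendsto_edgeEnergy (𝒩 : Network G d) (i : ι) {x : ℕ → ℝ} (hx0 : ∀ n, 0 < x n)
    (hx1 : ∀ n, x n ≤ 1) (hx : Tendsto x atTop (𝓝 0)) {δ : ℝ → G.Vertex → Euc d}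
    {b : ℝ → ι → Euc d} (hδ : ∀ p, Tendsto (fun x => δ x p) (𝓝 0) (𝓝 0))
    (hreg : i ∉ 𝒩.sing → ∀ x, b x i = 0)
    (hsing : i ∈ 𝒩.sing → ∃ (k : ℕ) (c C : ℝ), k ≠ 0 ∧ 0 < c ∧ ∀ x, 0 < x → x ≤ 1 →
        ‖b x i‖ = c * x ^ k ∧
        ‖δ x (G.proj (1, i)) - δ x (G.proj (0, i)) - b x i‖ ≤ C * (x ^ k) ^ 2)
    {η : ℕ → ℝ → Euc d}
    (hη : ∀ n, EqOn (η n) (fun t => 𝒩.curve i t + edgeCorrection G (δ (x n)) (b (x n)) i t)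
      (Icc 0 1)) :
    Tendsto (fun n => ∫ t in (0 : ℝ)..1, bendingDensity (η n) t) atTop
      (𝓝 (∫ t in (0 : ℝ)..1, ‖𝒩.curvature i t‖ ^ 2 * ‖d1 (𝒩.curve i) t‖)) ∧
    Tendsto (fun n => curveLength (η n)) atTop (𝓝 (curveLength (𝒩.curve i))) ∧
    (∀ᶠ n in atTop, IsH2Immersion (η n)) ∧
    Tendsto (fun n => h2Norm (fun t => η n t - 𝒩.curve i t)) atTop (𝓝 0) := by
  have hδx : ∀ p, Tendsto (fun n => δ (x n) p) atTop (𝓝 0) := fun p => (hδ p).comp hx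
  have hΔ : Tendsto (fun n => δ (x n) (G.proj (1, i)) - δ (x n) (G.proj (0, i))) atTop (𝓝 0) := by
    simpa using (hδx (G.proj (1, i))).sub (hδx (G.proj (0, i)))
  have hH2 : Tendsto (fun n => b (x n) i) atTop (𝓝 0) →
      Tendsto (fun n => h2Norm (fun t => η n t - 𝒩.curve i t)) atTop (𝓝 0) := by
    intro hb
    have hw := hΔ.sub hb
    rw [sub_zero] at hw
    refine (tendsto_h2Norm_cubicCurve (hδx (G.proj (0, i))) hb hw).congr fun n => ?_
    refine h2Norm_congr fun t ht => ?_
    simp only [hη n ht, add_sub_cancel_left, edgeCorrection]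
  by_cases hi : i ∈ 𝒩.sing
  · obtain ⟨k, c, C, hk, hc, hbd⟩ := hsing hi
    have hxk : Tendsto (fun n => x n ^ k) atTop (𝓝 0) := by
      simpa [hk] using hx.pow k
    have hb : Tendsto (fun n => b (x n) i) atTop (𝓝 0) := by
      rw [tendsto_zero_iff_norm_tendsto_zero]
      simp only [fun n => (hbd (x n) (hx0 n) (hx1 n)).1]
      simpa using hxk.const_mul c
    obtain ⟨γ₀, hγ₀⟩ := id hi
    -- A constant edge plus its correction is again a cubic, with scale $\varepsilon=x^k$.
    obtain ⟨h1, h2, h3⟩ := tendsto_energy_cubicCurve hc (fun n => pow_pos (hx0 n) k) hxk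
      (fun n => (hbd (x n) (hx0 n) (hx1 n)).1) (fun n => (hbd (x n) (hx0 n) (hx1 n)).2)
      (a := fun n => γ₀ + δ (x n) (G.proj (0, i))) (η := η) (fun n t ht => by
        simp only [hη n ht, hγ₀ t ht, edgeCorrection, cubicCurve, add_assoc])
    refine ⟨?_, ?_, h3, hH2 hb⟩
    · simpa [curvature, hi] using h1
    · rwa [curveLength_of_mem_sing hi]
  · have hb : ∀ x, b x i = 0 := hreg hi
    obtain ⟨h1, h2, h3⟩ := (𝒩.isH2Immersion_of_notMem_sing hi).tendsto_energy
      (fun n => δ (x n) (G.proj (0, i))) hΔ (η := η) (fun n t ht => by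
        simp only [hη n ht, edgeCorrection, hb, sub_zero])
    refine ⟨?_, h2, h3, hH2 (by simp [hb])⟩
    simpa [curvature, hi, bendingDensity] using h1

/-- The outer tangents of a corrected edge are the given real or virtual tangents. -/
theorem outerTangent_corrected {D : Directions ι d} {𝒩 : Network G d} {τ : TangentFamily ι d}
    (hτ : 𝒩.AngleConditionWith D τ) {δ : G.Vertex → Euc d} {b : ι → Euc d} {i : ι}
    (hreg : i ∉ 𝒩.sing → b i = 0) (hsing : i ∈ 𝒩.sing → ‖b i‖⁻¹ • b i = τ (0, i))
    {η : ℝ → Euc d}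
    (hη : EqOn η (fun t => 𝒩.curve i t + edgeCorrection G δ b i t) (Icc 0 1)) (z : Fin 2) :
    outerTangent η z = τ (z, i) := by
  have hd : d1 η (endParam z) = d1 (𝒩.curve i) (endParam z) + b i := by
    rw [d1_congr hη (endParam z).2]
    exact d1_add_cubicCurve_endParam (𝒩.isH2_curve i).differentiableOn _ _ _ z
  by_cases hi : i ∈ 𝒩.sing
  · obtain ⟨c, hc⟩ := id hi
    have h0 : d1 (𝒩.curve i) (endParam z) = 0 := by
      rw [d1_congr (g := fun _ => c) hc (endParam z).2, d1_const]; rfl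
    rw [outerTangent, hd, h0, zero_add, hsing hi]
    -- At $z=1$ the sign in the outer tangent matches $\tau^{0,i}=-\tau^{1,i}$.
    fin_cases z
    · simp
    · simp [hτ.virtual_opposite i hi]
  · rw [outerTangent, hd, hreg hi, add_zero, hτ.real i hi z, outerTangent]

end Network

/-! ### The recovery sequence -/

theorem mainTheorem3 {N d : ℕ} (hd : 2 ≤ d) (α β : ℝ) (hα : 0 < α) (hβ : 0 < β)
    (G : NGraph (Fin N)) (D : Directions (Fin N) d) (𝒩 : Network G d) (h𝒩 : 𝒩.InCDeg D) :
    ∃ 𝒩s : ℕ → Network G d,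
      (∀ n, (𝒩s n).InCReg D) ∧
      Network.TendstoH2 𝒩s 𝒩 ∧
      Tendsto (fun n => (((𝒩s n).energy α β : ℝ) : EReal)) atTop
        (𝓝 (𝒩.relaxedEnergy α β D)) := by
  obtain ⟨τ, hτ, δ, b, hδ, hreg, hsing⟩ := h𝒩.exists_displacements
  have hedge : ∀ i, i ∈ 𝒩.sing → ∃ (k : ℕ) (c C : ℝ), k ≠ 0 ∧ 0 < c ∧ ∀ x, 0 < x → x ≤ 1 →
      ‖b x i‖ = c * x ^ k ∧
      ‖δ x (G.proj (1, i)) - δ x (G.proj (0, i)) - b x i‖ ≤ C * (x ^ k) ^ 2 := by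
    intro i hi
    obtain ⟨k, c, C, hk, hc, h⟩ := hsing i hi
    exact ⟨k, c, C, hk, hc, fun x h0 h1 => ⟨(h x h0 h1).1, (h x h0 h1).2.2⟩⟩
  have hdir : ∀ i, i ∈ 𝒩.sing → ∀ x, 0 < x → x ≤ 1 → ‖b x i‖⁻¹ • b x i = τ (0, i) := by
    intro i hi x h0 h1
    obtain ⟨k, c, C, hk, hc, h⟩ := hsing i hi
    exact (h x h0 h1).2.1
  have hy0 : ∀ n : ℕ, (0 : ℝ) < 1 / (n + 1) := fun n => by positivity
  have hy1 : ∀ n : ℕ, (1 : ℝ) / (n + 1) ≤ 1 := fun n => by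
    rw [div_le_one (by positivity)]; linarith [n.cast_nonneg (α := ℝ)]
  have himm : ∀ᶠ n : ℕ in atTop, ∀ i, IsH2Immersion fun t => 𝒩.curve i t +
      Network.edgeCorrection G (δ (1 / ((n : ℝ) + 1))) (b (1 / ((n : ℝ) + 1))) i t :=
    eventually_all.2 fun i => (𝒩.tendsto_edgeEnergy i hy0 hy1
      tendsto_one_div_add_atTop_nhds_zero_nat hδ (hreg i) (hedge i) fun _ => eqOn_refl _ _).2.2.1
  -- Corrected edges are immersions only for small `x`; shifting the index by `n₀` makes every
  -- member of the sequence regular.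
  obtain ⟨n₀, hn₀⟩ := eventually_atTop.1 himm
  set x : ℕ → ℝ := fun n => 1 / (((n + n₀ : ℕ) : ℝ) + 1) with hxdef
  have hx0 : ∀ n, 0 < x n := fun n => hy0 _
  have hx1 : ∀ n, x n ≤ 1 := fun n => hy1 _
  have hx : Tendsto x atTop (𝓝 0) :=
    (tendsto_add_atTop_iff_nat n₀).2 (tendsto_one_div_add_atTop_nhds_zero_nat (𝕜 := ℝ))
  choose 𝒩s h𝒩s using fun n => 𝒩.exists_corrected (δ (x n)) (b (x n))
    (hn₀ (n + n₀) (Nat.le_add_left _ _))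
  have himm' : ∀ n i, IsH2Immersion ((𝒩s n).curve i) := fun n i =>
    (hn₀ (n + n₀) (Nat.le_add_left _ _) i).congr (h𝒩s n i)
  have hregular : ∀ n, (𝒩s n).IsRegular := fun n =>
    eq_empty_of_forall_notMem fun i => (himm' n i).not_isConstantCurve
  have hlim := fun i => 𝒩.tendsto_edgeEnergy i hx0 hx1 hx hδ (hreg i) (hedge i)
    fun n => h𝒩s n i
  refine ⟨𝒩s, fun n => ⟨hregular n, fun p => ?_⟩, fun i => ?_, ?_⟩
  · obtain ⟨R, hR, hRτ⟩ := hτ.angles p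
    refine ⟨R, hR, fun z i hp => ?_⟩
    rw [Network.outerTangent_corrected hτ (fun hi => hreg i hi _)
      (fun hi => hdir i hi _ (hx0 n) (hx1 n)) (h𝒩s n i) z]
    exact hRτ z i hp
  · exact ⟨fun _ t => t, fun t => t, fun _ => isReparam_id, isReparam_id, (hlim i).2.2.2⟩
  · rw [Network.relaxedEnergy, if_pos h𝒩]
    refine (continuous_coe_real_ereal.tendsto _).comp ?_
    simp only [Network.energy_of_isRegular α β (hregular _)]
    exact tendsto_finsetSum _ fun i _ =>
      ((hlim i).1.const_mul α).add ((hlim i).2.1.const_mul β)
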